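/- Call a group $G$ \emph{relatively free} with basis $\mathcal X\subseteq G$ if $\mathcal X$ generates $G$ and the kernel of the canonical homomorphism from the free group on $\mathcal X$ onto $G$ is fully invariant (equivalently, $\mathcal X$ generates $G$ and every map $\mathcal X\to G$ extends to an endomorphism of $G$); the rank of $G$ is $|\mathcal X|$. Let $G$ be a relatively free group of infinite rank $\varkappa$ with trivial center, let $\Gamma=\mathrm{Aut}(G)$, and for $\sigma\in\Gamma$ let $\sigma^\Gamma$ be its conjugacy class in $\Gamma$. Call $\sigma^\Gamma$ \emph{small} if $|\sigma^\Gamma|\le\varkappa$. Then: (i) if $\rho\in\Gamma$ and $|\rho^\Gamma|<\varkappa$, then $\rho$ is the identity; (ii) $\min\{|\pi^\Gamma| : \pi\in\Gamma,\ \pi\ne\mathrm{id}\}=\varkappa$ (in particular, the minimum is taken over a nonempty set); (iii) for every nonidentity $\sigma\in\Gamma$, the class $\sigma^\Gamma$ is small if and only if $|\sigma^\Gamma|\le|\pi^\Gamma|$ for every nonidentity $\pi\in\Gamma$; (iv) the set $S$ of all elements of $\Gamma$ whose conjugacy class is small is a subgroup of $\Gamma$, and it is characteristic in $\Gamma$.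 -/

import Mathlib

open Cardinal

universe u

/-- `X` is a basis of the relatively free group `G`: `X` generates `G`, and the kernel of the
canonical epimorphism from the free group on `X` onto `G` is fully invariant. In other words,
`G` is the quotient `F / R` of a free group by a fully invariant subgroup, and `X` is
the image of a basis of `F` (on which the quotient map is injective). -/
structure IsRelFreeBasis {G : Type u} [Group G] (X : Set G) : Prop where
  generates : Subgroup.closure X = ⊤
  ker_fullyInvariant : ∀ (φ : FreeGroup X →* FreeGroup X) (w : FreeGroup X),
    w ∈ (FreeGroup.lift (fun x : X => (x : G))).ker →
      φ w ∈ (FreeGroup.lift (fun x : X => (x : G))).ker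

/-- Sanity check: the kernel is fully invariant exactly when each map from `X` to `G`
extends to an endomorphism of `G`. -/
theorem isRelFreeBasis_iff {G : Type u} [Group G] (X : Set G) :
    IsRelFreeBasis X ↔ Subgroup.closure X = ⊤ ∧
      ∀ f : X → G, ∃ φ : G →* G, ∀ x : X, φ x = f x := by
  set p := FreeGroup.lift (fun x : X => (x : G)) with hp
  have hr : p.range = Subgroup.closure X := by
    rw [hp, FreeGroup.range_lift_eq_closure]; simp
  constructor
  · rintro ⟨hg, hk⟩
    refine ⟨hg, fun f => ?_⟩
    have hs : Function.Surjective p := MonoidHom.range_eq_top.mp (hr.trans hg)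
    choose g hgf using fun x => hs (f x)
    let ψ : FreeGroup X →* FreeGroup X := FreeGroup.lift g
    refine ⟨p.liftOfSurjective hs ⟨p.comp ψ, fun w hw => ?_⟩, fun x => ?_⟩
    · exact hk ψ w hw
    · have h := p.liftOfRightInverse_comp_apply _ (Function.rightInverse_surjInv hs)
        ⟨p.comp ψ, fun w hw => hk ψ w hw⟩ (FreeGroup.of x)
      have hx : p (FreeGroup.of x) = x := by simp [hp]
      rw [hx] at h
      refine h.trans ?_
      simp [ψ, hgf]
  · rintro ⟨hg, hf⟩
    refine ⟨hg, fun ψ w hw => ?_⟩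
    obtain ⟨φ, hφ⟩ := hf (fun x => p (ψ (FreeGroup.of x)))
    have hc : p.comp ψ = φ.comp p := by
      ext x
      simp [hp, hφ]
    have := DFunLike.congr_fun hc w
    simp only [MonoidHom.comp_apply] at this
    rw [MonoidHom.mem_ker] at hw ⊢
    rw [this, hw, map_one]

/-- `G` is a relatively free group of rank `κ`: it has a basis of cardinality `κ`. -/
def IsRelFreeOfRank (G : Type u) [Group G] (κ : Cardinal.{u}) : Prop :=
  ∃ X : Set G, IsRelFreeBasis X ∧ #X = κ

/-- The conjugacy class of the automorphism `σ` in `Aut G` has at most `κ` elements. -/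
def HasSmallClass {G : Type u} [Group G] (κ : Cardinal.{u}) (σ : MulAut G) : Prop :=
  #(conjugatesOf σ) ≤ κ

/-- The subgroup of `Aut G` formed by the automorphisms whose conjugacy class has at most `κ`
elements, for an infinite cardinal `κ`. -/
def smallClassSubgroup (G : Type u) [Group G] (κ : Cardinal.{u}) (hκ : ℵ₀ ≤ κ) :
    Subgroup (MulAut G) where
  carrier := {σ | HasSmallClass κ σ}
  one_mem' := by
    have h : conjugatesOf (1 : MulAut G) = {1} := by
      ext σ
      simp [conjugatesOf]
    change #(conjugatesOf (1 : MulAut G)) ≤ κ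
    rw [h, Cardinal.mk_singleton]
    exact Cardinal.one_le_aleph0.trans hκ
  mul_mem' := by
    intro σ τ hσ hτ
    have hsub : conjugatesOf (σ * τ) ⊆ Set.image2 (· * ·) (conjugatesOf σ) (conjugatesOf τ) := by
      intro ρ hρ
      obtain ⟨c, rfl⟩ := isConj_iff.mp hρ
      exact ⟨c * σ * c⁻¹, isConj_iff.mpr ⟨c, rfl⟩, c * τ * c⁻¹, isConj_iff.mpr ⟨c, rfl⟩,
        by simp [mul_assoc]⟩
    calc #(conjugatesOf (σ * τ))
        ≤ #(Set.image2 (· * ·) (conjugatesOf σ) (conjugatesOf τ)) := Cardinal.mk_le_mk_of_subset hsub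
      _ ≤ #(conjugatesOf σ) * #(conjugatesOf τ) := Cardinal.mk_image2_le
      _ ≤ κ * κ := mul_le_mul' hσ hτ
      _ = κ := Cardinal.mul_eq_self hκ
  inv_mem' := by
    intro σ hσ
    have hsub : conjugatesOf σ⁻¹ ⊆ (fun ρ : MulAut G => ρ⁻¹) '' conjugatesOf σ := by
      intro ρ hρ
      obtain ⟨c, rfl⟩ := isConj_iff.mp hρ
      exact ⟨c * σ * c⁻¹, isConj_iff.mpr ⟨c, rfl⟩, by simp [mul_assoc]⟩
    exact ((Cardinal.mk_le_mk_of_subset hsub).trans Cardinal.mk_image_le).trans hσ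

/-! Conjugating `σ` by inner automorphisms already gives at least `κ` conjugates unless `σ = 1`.
With trivial center, a coincidence between the conjugates by `a` and `b` forces `σ` to fix `a⁻¹ *
b`. If the class has fewer than `κ` elements, pigeonhole on the basis yields `a ≠ b`, outside the
support of `u = σ g * g⁻¹`, such that `σ` fixes both `a⁻¹ * b` and its conjugate by `g`. Then `u`
commutes with `a⁻¹ * b`, hence is central by freeness, so `σ g = g`. Conversely, inner automorphisms
have at most `#G ≤ κ` conjugates, so `κ` is attained. -/

/-- Two inner conjugates of `σ` coincide only if `σ` fixes the quotient of the conjugators,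
provided that the center is trivial. -/
theorem apply_inv_mul_eq_of_conj_eq {G : Type u} [Group G] (hZ : Subgroup.center G = ⊥)
    {σ : MulAut G} {g h : G}
    (hgh : MulAut.conj g * σ * (MulAut.conj g)⁻¹ = MulAut.conj h * σ * (MulAut.conj h)⁻¹) :
    σ (g⁻¹ * h) = g⁻¹ * h := by
  -- The conjugate of `σ` by `MulAut.conj g` is `MulAut.conj (g * (σ g)⁻¹) * σ`; evaluate at `σ.symm
  -- t`.
  have key : ∀ t : G, g * (σ g)⁻¹ * t * (g * (σ g)⁻¹)⁻¹ = h * (σ h)⁻¹ * t * (h * (σ h)⁻¹)⁻¹ := by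
    intro t
    have := DFunLike.congr_fun hgh (σ.symm t)
    simpa [MulAut.mul_apply, MulAut.conj_apply, mul_assoc] using this
  have hc : (h * (σ h)⁻¹)⁻¹ * (g * (σ g)⁻¹) ∈ Subgroup.center G := by
    rw [Subgroup.mem_center_iff]
    intro t
    have := key t
    generalize g * (σ g)⁻¹ = p, h * (σ h)⁻¹ = q at this
    calc t * (q⁻¹ * p) = q⁻¹ * (q * t * q⁻¹) * p := by group
      _ = q⁻¹ * p * t := by rw [← this]; group
  rw [hZ, Subgroup.mem_bot, inv_mul_eq_one, mul_inv_eq_iff_eq_mul, mul_assoc] at hc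
  rw [map_mul, map_inv, eq_inv_mul_iff_mul_eq]
  exact hc.symm

/-- Each element of a group generated by `X` is fixed by every endomorphism that fixes
a suitable finite subset of `X` pointwise. -/
theorem exists_finite_support {G : Type u} [Group G] {X : Set G}
    (hX : Subgroup.closure X = ⊤) (u : G) :
    ∃ Y : Set G, Y.Finite ∧ ∀ φ : G →* G, (∀ x ∈ X, x ∈ Y → φ x = x) → φ u = u := by
  have hu : u ∈ Subgroup.closure X := hX ▸ Subgroup.mem_top u
  induction hu using Subgroup.closure_induction with
  | mem x hx => exact ⟨{x}, Set.finite_singleton x, fun φ h => h x hx rfl⟩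
  | one => exact ⟨∅, Set.finite_empty, fun φ _ => map_one φ⟩
  | mul a b _ _ iha ihb =>
    obtain ⟨A, hA, ha⟩ := iha
    obtain ⟨B, hB, hb⟩ := ihb
    refine ⟨A ∪ B, hA.union hB, fun φ h => ?_⟩
    rw [map_mul, ha φ fun x hx hxA => h x hx (Or.inl hxA),
      hb φ fun x hx hxB => h x hx (Or.inr hxB)]
  | inv a _ iha =>
    obtain ⟨A, hA, ha⟩ := iha
    exact ⟨A, hA, fun φ h => by rw [map_inv, ha φ h]⟩

/-- In a relatively free group with trivial center, only the trivial element commutes with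
`a⁻¹ * b` for basis elements `a ≠ b` outside its support. -/
theorem eq_one_of_commute_inv_mul {G : Type u} [Group G] {X : Set G} (hX : IsRelFreeBasis X)
    (hZ : Subgroup.center G = ⊥) {u : G} {Y : Set G}
    (hY : ∀ φ : G →* G, (∀ x ∈ X, x ∈ Y → φ x = x) → φ u = u)
    {a b : G} (ha : a ∈ X) (hb : b ∈ X) (haY : a ∉ Y) (hbY : b ∉ Y) (hab : a ≠ b)
    (hu : Commute u (a⁻¹ * b)) : u = 1 := by
  classical
  rw [← Subgroup.mem_bot, ← hZ, Subgroup.mem_center_iff]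
  intro t
  -- This endomorphism fixes `u` and sends `a⁻¹ * b` to the arbitrary element `t`.
  obtain ⟨φ, hφ⟩ := ((isRelFreeBasis_iff X).mp hX).2
    fun x => if (x : G) = a then 1 else if (x : G) = b then t else x
  have h1 : φ a = 1 := by simpa using hφ ⟨a, ha⟩
  have h2 : φ b = t := by simpa [hab.symm] using hφ ⟨b, hb⟩
  have h3 : φ u = u := hY φ fun x hx hxY => by
    have hxa : x ≠ a := fun h => haY (h ▸ hxY)
    have hxb : x ≠ b := fun h => hbY (h ▸ hxY)
    simpa [hxa, hxb] using hφ ⟨x, hx⟩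
  have h := hu.map φ
  rw [map_mul, map_inv, h1, h2, h3, inv_one, one_mul] at h
  exact h.eq.symm

theorem eq_one_of_mk_conjugatesOf_lt {G : Type u} [Group G] {κ : Cardinal.{u}} (hκ : ℵ₀ ≤ κ)
    (hG : IsRelFreeOfRank G κ) (hZ : Subgroup.center G = ⊥) {σ : MulAut G}
    (hσ : #(conjugatesOf σ) < κ) : σ = 1 := by
  obtain ⟨X, hX, hXκ⟩ := hG
  ext g
  obtain ⟨Y, hYfin, hY⟩ := exists_finite_support hX.generates (σ g * g⁻¹)
  have hcard : κ ≤ #(X \ Y : Set G) := by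
    by_contra! hlt
    have := Cardinal.add_lt_of_lt hκ hlt (hYfin.lt_aleph0.trans_le hκ)
    exact (Cardinal.le_mk_sdiff_add_mk X Y).not_gt (hXκ.symm ▸ this)
  let c : G → conjugatesOf σ := fun h =>
    ⟨MulAut.conj h * σ * (MulAut.conj h)⁻¹, isConj_iff.mpr ⟨_, rfl⟩⟩
  have hc : ∀ {h k : G}, c h = c k → σ (h⁻¹ * k) = h⁻¹ * k := fun e =>
    apply_inv_mul_eq_of_conj_eq hZ (congrArg Subtype.val e)
  -- The second coordinate makes a collision also give the fixed point `g⁻¹ * (a⁻¹ * b) * g`.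
  let f : (X \ Y : Set G) → conjugatesOf σ × conjugatesOf σ := fun x => (c x, c (x * g))
  have hf : ¬ Function.Injective f := fun hinj =>
    (hcard.trans (Cardinal.mk_le_of_injective hinj)).not_gt
      (by simpa using Cardinal.mul_lt_of_lt hκ hσ hσ)
  obtain ⟨⟨a, ha⟩, ⟨b, hb⟩, hfab, hne⟩ : ∃ a b, f a = f b ∧ a ≠ b := Function.not_injective_iff.mp hf
  have h1 : σ (a⁻¹ * b) = a⁻¹ * b := hc (congrArg Prod.fst hfab)
  have h2 : σ ((a * g)⁻¹ * (b * g)) = (a * g)⁻¹ * (b * g) := hc (congrArg Prod.snd hfab)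
  rw [show (a * g)⁻¹ * (b * g) = g⁻¹ * (a⁻¹ * b) * g by group, map_mul, map_mul, map_inv, h1] at h2
  have hcomm : Commute (σ g * g⁻¹) (a⁻¹ * b) := by
    have h3 := congrArg (fun z => σ g * z * g⁻¹) h2
    simp only [mul_assoc, mul_inv_cancel_left, mul_inv_cancel, mul_one] at h3
    simpa [Commute, SemiconjBy, mul_assoc] using h3.symm
  have := eq_one_of_commute_inv_mul hX hZ hY ha.1 hb.1 ha.2 hb.2 (fun h => hne (Subtype.ext h)) hcomm
  simpa [mul_inv_eq_one] using this

theorem mk_le_of_isRelFreeOfRank {G : Type u} [Group G] {κ : Cardinal.{u}} (hκ : ℵ₀ ≤ κ)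
    (hG : IsRelFreeOfRank G κ) : #G ≤ κ := by
  obtain ⟨X, hX, rfl⟩ := hG
  have hs : Function.Surjective (FreeGroup.lift (fun x : X => (x : G))) := by
    rw [← MonoidHom.range_eq_top, FreeGroup.range_lift_eq_closure, Subtype.range_coe, hX.generates]
  refine (Cardinal.mk_le_of_surjective hs).trans ?_
  have : Infinite X := Cardinal.infinite_iff.mpr hκ
  rw [Cardinal.mk_freeGroup]
  exact max_le le_rfl hκ

/-- Conjugating `MulAut.conj g` by `τ` gives `MulAut.conj (τ g)`, so the class stays among the inner
automorphisms. -/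
theorem mk_conjugatesOf_conj_le {G : Type u} [Group G] (g : G) :
    #(conjugatesOf (MulAut.conj g)) ≤ #G := by
  refine (Cardinal.mk_le_mk_of_subset ?_).trans (Cardinal.mk_range_le (f := fun h : G => MulAut.conj h))
  intro ρ hρ
  obtain ⟨τ, rfl⟩ := isConj_iff.mp hρ
  refine ⟨τ g, ?_⟩
  ext x
  simp [MulAut.mul_apply, MulAut.conj_apply]

/-- A nontrivial group with trivial center has a nontrivial inner automorphism. -/
theorem exists_conj_ne_one {G : Type u} [Group G] [Nontrivial G] (hZ : Subgroup.center G = ⊥) :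
    ∃ g : G, MulAut.conj g ≠ 1 := by
  obtain ⟨g, hg⟩ := exists_ne (1 : G)
  refine ⟨g, fun h => hg ?_⟩
  rw [← Subgroup.mem_bot, ← hZ, Subgroup.mem_center_iff]
  intro t
  have := DFunLike.congr_fun h t
  rw [MulAut.conj_apply, MulAut.one_apply, mul_inv_eq_iff_eq_mul] at this
  exact this.symm

theorem mk_conjugatesOf_map_le {Γ : Type u} [Group Γ] (φ : Γ ≃* Γ) (σ : Γ) :
    #(conjugatesOf (φ σ)) ≤ #(conjugatesOf σ) := by
  refine (Cardinal.mk_le_mk_of_subset ?_).trans (Cardinal.mk_image_le (f := φ))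
  intro ρ hρ
  obtain ⟨c, rfl⟩ := isConj_iff.mp hρ
  exact ⟨φ.symm c * σ * (φ.symm c)⁻¹, isConj_iff.mpr ⟨_, rfl⟩, by simp⟩

theorem mainTheorem6 {G : Type u} [Group G] (κ : Cardinal.{u}) (hκ : ℵ₀ ≤ κ)
    (hG : IsRelFreeOfRank G κ) (hZ : Subgroup.center G = ⊥) :
    (∀ ρ : MulAut G, #(conjugatesOf ρ) < κ → ρ = 1) ∧
    IsLeast {c : Cardinal.{u} | ∃ π : MulAut G, π ≠ 1 ∧ #(conjugatesOf π) = c} κ ∧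
    (∀ σ : MulAut G, σ ≠ 1 →
      (HasSmallClass κ σ ↔ ∀ π : MulAut G, π ≠ 1 → #(conjugatesOf σ) ≤ #(conjugatesOf π))) ∧
    (smallClassSubgroup G κ hκ).Characteristic := by
  have hlt : ∀ ρ : MulAut G, #(conjugatesOf ρ) < κ → ρ = 1 := fun ρ =>
    eq_one_of_mk_conjugatesOf_lt hκ hG hZ
  have hge : ∀ π : MulAut G, π ≠ 1 → κ ≤ #(conjugatesOf π) := fun π hπ =>
    not_lt.mp fun h => hπ (hlt π h)
  have hinf : Infinite G := by
    obtain ⟨X, -, rfl⟩ := hG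
    exact Cardinal.infinite_iff.mpr (hκ.trans (Cardinal.mk_set_le X))
  obtain ⟨g, hg⟩ := exists_conj_ne_one hZ
  have hgκ : #(conjugatesOf (MulAut.conj g)) = κ :=
    ((mk_conjugatesOf_conj_le g).trans (mk_le_of_isRelFreeOfRank hκ hG)).antisymm (hge _ hg)
  refine ⟨hlt, ⟨⟨_, hg, hgκ⟩, ?_⟩, fun σ _ => ⟨fun h π hπ => h.trans (hge π hπ), fun h => ?_⟩, ?_⟩
  · rintro _ ⟨π, hπ, rfl⟩
    exact hge π hπ
  · exact (h _ hg).trans hgκ.le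
  · rw [Subgroup.characteristic_iff_map_le]
    rintro φ _ ⟨σ, hσ, rfl⟩
    exact (mk_conjugatesOf_map_le φ σ).trans hσ
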